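/- Let $R$ be a commutative Noetherian ring and let $A$ be a projective Noetherian $R$-algebra, i.e. a (not necessarily commutative) $R$-algebra which is finitely generated and projective as an $R$-module. Put $D=\operatorname{Hom}_R(-,R)$; for a maximal ideal $\mathfrak m$ of $R$ put $R(\mathfrak m)=R/\mathfrak m$, and write $X(\mathfrak m)=R(\mathfrak m)\otimes_R X$, so that $A(\mathfrak m)$ is a finite-dimensional $R(\mathfrak m)$-algebra and $X(\mathfrak m)$ is an $A(\mathfrak m)$-module for each finitely generated left $A$-module $X$. For finitely generated left $A$-modules $Q$ and $M$ that are projective over $R$, the relative dominant dimension $Q\text{-}\operatorname{domdim}_{(A,R)} M\in\{0,1,2,\dots\}\cup\{\infty\}$ of $M$ with respect to $Q$ is the supremum of all integers $n\ge 1$ for which there is a sequence of $A$-modules $$0\to M\to X_1\to\cdots\to X_n$$ that is $(A,R)$-exact (exact, and split as a sequence of $R$-modules; in particular the image of the last map is an $R$-direct summand of $X_n$), whose terms $X_i$ are all direct summands of finite direct sums of copies of $Q$, and which remains exact under $\operatorname{Hom}_A(-,Q)$, i.e. $\operatorname{Hom}_A(X_n,Q)\to\cdots\to\operatorname{Hom}_A(X_1,Q)\to\operatorname{Hom}_A(M,Q)\to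 0$ is exact; it is $0$ if there is no such $n$. For the finite-dimensional algebra $A(\mathfrak m)$ over the field $R(\mathfrak m)$ write $\operatorname{domdim}_{A(\mathfrak m)}$ for $\operatorname{domdim}_{(A(\mathfrak m),R(\mathfrak m))}$. **Theorem.** Let $Q$ and $M$ be finitely generated left $A$-modules which are projective over $R$, and assume that $DQ\otimes_A Q$ is projective over $R$. Suppose that 1. $\operatorname{Hom}_A(M,Q)$ is projective over $R$; and 2. for every maximal ideal $\mathfrak m$ of $R$ the canonical map $R(\mathfrak m)\otimes_R\operatorname{Hom}_A(M,Q)\to\operatorname{Hom}_{A(\mathfrak m)}(M(\mathfrak m),Q(\mathfrak m))$, $s\otimes f\mapsto (t\otimes x\mapsto st\otimes f(x))$, is an isomorphism. Then $$Q\text{-}\operatorname{domdim}_{(A,R)} M=\inf\{\,Q(\mathfrak m)\text{-}\operatorname{domdim}_{A(\mathfrak m)} M(\mathfrak m) : \mathfrak m \text{ a maximal ideal of } R\,\},$$ where the infimum of the empty set (which occurs only for $R=0$) is $\infty$. -/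

import Mathlib

open scoped TensorProduct

universe w

/-! ### Additive closure and relative dominant dimension -/

/-- `X ∈ add_A Q`: the `A`-module `X` is (isomorphic to) a direct summand of a finite direct sum of
copies of `Q`. -/
def InAdd (A : Type*) [Ring A] (Q : Type*) [AddCommGroup Q] [Module A Q]
    (X : Type*) [AddCommGroup X] [Module A X] : Prop :=
  ∃ (k : ℕ) (i : X →ₗ[A] (Fin k → Q)) (p : (Fin k → Q) →ₗ[A] X), p ∘ₗ i = LinearMap.id

/-- The image of an `A`-linear map is a direct summand of the target as an `R`-module. -/
def HasSplitRange (R : Type*) [CommRing R] {A : Type*} [Ring A] [Algebra R A]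
    {X : Type*} [AddCommGroup X] [Module R X] [Module A X] [IsScalarTower R A X]
    {Y : Type*} [AddCommGroup Y] [Module R Y] [Module A Y] [IsScalarTower R A Y]
    (f : X →ₗ[A] Y) : Prop :=
  IsComplemented (LinearMap.range (f.restrictScalars R))

/-- An `(A, R)`-exact sequence `0 → M → X 0 → X 1 → ⋯ → X (n - 1)` with all terms `X i` in `add_A Q`
which remains exact under `Hom_A(-, Q)`. Only the data `X i` with `i < n`, `d i` with `i + 1 < n`,
and, if `n ≠ 0`, `ι`, are constrained. The sequence being `(A, R)`-exact means that it is an exact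
sequence of `A`-modules which splits over `R`, i.e. the image of each map (including the last one)
is an `R`-direct summand. Remaining exact under `Hom_A(-, Q)` means that
`Hom_A(X (n - 1), Q) → ⋯ → Hom_A(X 0, Q) → Hom_A(M, Q) → 0` is exact. -/
structure AddCoresolution (R : Type*) [CommRing R] (A : Type*) [Ring A] [Algebra R A]
    (Q : Type*) [AddCommGroup Q] [Module A Q]
    (M : Type*) [AddCommGroup M] [Module R M] [Module A M] [IsScalarTower R A M]
    (n : ℕ) (X : ℕ → Type*) [∀ i, AddCommGroup (X i)] [∀ i, Module R (X i)]
    [∀ i, Module A (X i)] [∀ i, IsScalarTower R A (X i)] where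
  ι : M →ₗ[A] X 0
  d : ∀ i, X i →ₗ[A] X (i + 1)
  inAdd : ∀ i, i < n → InAdd A Q (X i)
  -- exactness
  injective : 0 < n → Function.Injective ι
  exact_zero : 1 < n → Function.Exact ι (d 0)
  exact_succ : ∀ i, i + 2 < n → Function.Exact (d i) (d (i + 1))
  -- splitting over `R`
  split_zero : 0 < n → HasSplitRange R ι
  split_succ : ∀ i, i + 1 < n → HasSplitRange R (d i)
  -- exactness after applying `Hom_A(-, Q)`
  hom_surjective : 0 < n →
    Function.Surjective (fun g : X 0 →ₗ[A] Q => g ∘ₗ ι)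
  hom_exact_zero : 1 < n →
    Function.Exact (fun g : X 1 →ₗ[A] Q => g ∘ₗ d 0) (fun g : X 0 →ₗ[A] Q => g ∘ₗ ι)
  hom_exact_succ : ∀ i, i + 2 < n →
    Function.Exact (fun g : X (i + 1 + 1) →ₗ[A] Q => g ∘ₗ d (i + 1))
      (fun g : X (i + 1) →ₗ[A] Q => g ∘ₗ d i)

/-- There is an `(A, R)`-exact sequence `0 → M → X₁ → ⋯ → Xₙ`, with all `Xᵢ ∈ add_A Q`, which
remains exact under `Hom_A(-, Q)`. (All modules in `add_A Q` have copies in the universe of `Q`.) -/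
def HasAddCoresolution (R : Type*) [CommRing R] (A : Type*) [Ring A] [Algebra R A]
    (Q : Type w) [AddCommGroup Q] [Module A Q]
    (M : Type*) [AddCommGroup M] [Module R M] [Module A M] [IsScalarTower R A M]
    (n : ℕ) : Prop :=
  ∃ (X : ℕ → Type w) (_ : ∀ i, AddCommGroup (X i)) (_ : ∀ i, Module R (X i))
    (_ : ∀ i, Module A (X i)) (_ : ∀ i, IsScalarTower R A (X i)),
    Nonempty (AddCoresolution R A Q M n X)

/-- The relative dominant dimension `Q-domdim_{(A,R)} M ∈ ℕ ∪ {∞}` of `M` with respect to `Q`: the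
supremum of all `n ≥ 1` such that there is an `(A, R)`-exact sequence `0 → M → X₁ → ⋯ → Xₙ` with all
`Xᵢ ∈ add_A Q` which remains exact under `Hom_A(-, Q)`. The sequences for `n = 1` are the left
`add_A Q`-approximations of `M` which are `(A, R)`-monomorphisms; if there are none, then there is
no sequence for any `n ≥ 1` and the supremum is `0`. -/
noncomputable def relDomDim (R : Type*) [CommRing R] (A : Type*) [Ring A] [Algebra R A]
    (Q : Type*) [AddCommGroup Q] [Module A Q]
    (M : Type*) [AddCommGroup M] [Module R M] [Module A M] [IsScalarTower R A M] : ℕ∞ :=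
  ⨆ (n : ℕ) (_ : 1 ≤ n ∧ HasAddCoresolution R A Q M n), (n : ℕ∞)

/-! ### The tensor product `DQ ⊗_A Q` -/

section DualTensor

variable (R : Type*) [CommRing R] (A : Type*) [Ring A] [Algebra R A]

/-- The tensor product `N ⊗_A M` of a right `A`-module `N` and a left `A`-module `M`, as an
`R`-module: the quotient of `N ⊗_R M` by the span of all `n a ⊗ m - n ⊗ a m`. -/
abbrev BalancedTensor (N : Type*) [AddCommGroup N] [Module R N] [Module Aᵐᵒᵖ N]
    (M : Type*) [AddCommGroup M] [Module R M] [Module A M] : Type _ :=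
  (N ⊗[R] M) ⧸ Submodule.span R
    {x : N ⊗[R] M | ∃ (n : N) (a : A) (m : M),
      x = (MulOpposite.op a • n) ⊗ₜ[R] m - n ⊗ₜ[R] (a • m)}

variable (Q : Type*) [AddCommGroup Q] [Module R Q] [Module A Q] [IsScalarTower R A Q]

/-- `DQ = Hom_R(Q, R)` as a right `A`-module: `(f a)(q) = f (a q)`. -/
@[reducible] def dualRightModule : Module Aᵐᵒᵖ (Q →ₗ[R] R) where
  smul a f := f ∘ₗ Algebra.lsmul R R Q a.unop
  one_smul f := LinearMap.ext fun q => congrArg f (one_smul A q)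
  mul_smul a b f := LinearMap.ext fun q => congrArg f (mul_smul b.unop a.unop q)
  smul_zero _ := LinearMap.ext fun _ => rfl
  smul_add _ _ _ := LinearMap.ext fun _ => rfl
  add_smul a b f := LinearMap.ext fun q =>
    (congrArg f (add_smul a.unop b.unop q)).trans (map_add f _ _)
  zero_smul f := LinearMap.ext fun q => (congrArg f (zero_smul A q)).trans (map_zero f)

/-- The `R`-module `DQ ⊗_A Q`. -/
abbrev DualTensor : Type _ :=
  letI : Module Aᵐᵒᵖ (Q →ₗ[R] R) := dualRightModule R A Q
  BalancedTensor R A (Q →ₗ[R] R) Q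

end DualTensor

/-! ### Change of rings -/

section BaseChange

variable (R : Type*) [CommRing R] (S : Type*) [CommRing S] [Algebra R S]
  (A : Type*) [Ring A] [Algebra R A]
  (M : Type*) [AddCommGroup M] [Module R M] [Module A M] [IsScalarTower R A M]
  (Q : Type*) [AddCommGroup Q] [Module R Q] [Module A Q] [IsScalarTower R A Q]

/-- The action of `S ⊗_R A` on `S ⊗_R M`: `(s ⊗ a) (t ⊗ m) = s t ⊗ a m`. -/
noncomputable def baseChangeAction : S ⊗[R] A →ₐ[S] Module.End S (S ⊗[R] M) :=
  Algebra.TensorProduct.lift (Algebra.ofId S (Module.End S (S ⊗[R] M)))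
    ((Module.End.baseChangeHom R S M).comp (Algebra.lsmul R R M))
    (fun s _ => by rw [Algebra.ofId_apply]; exact Algebra.commutes s _)

/-- `S ⊗_R M` as a left module over `S ⊗_R A`. -/
noncomputable instance baseChangeModule : Module (S ⊗[R] A) (S ⊗[R] M) :=
  Module.compHom (S ⊗[R] M) (baseChangeAction R S A M).toRingHom

theorem baseChange_smul_def (x : S ⊗[R] A) (y : S ⊗[R] M) :
    x • y = baseChangeAction R S A M x y := rfl

theorem baseChange_tmul_smul_tmul (s t : S) (a : A) (m : M) :
    (s ⊗ₜ[R] a) • (t ⊗ₜ[R] m) = (s * t) ⊗ₜ[R] (a • m) := by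
  rw [baseChange_smul_def, baseChangeAction, Algebra.TensorProduct.lift_tmul, Algebra.ofId_apply]
  exact TensorProduct.smul_tmul' s t (a • m)

instance baseChange_isScalarTower : IsScalarTower S (S ⊗[R] A) (S ⊗[R] M) where
  smul_assoc s x y := by
    simp [baseChange_smul_def]

variable {M Q}

/-- The base change `t ⊗ m ↦ t ⊗ f m` of an `A`-linear map `f`. -/
noncomputable def baseChangeMap (f : M →ₗ[A] Q) : S ⊗[R] M →ₗ[S ⊗[R] A] S ⊗[R] Q where
  toFun := (f.restrictScalars R).baseChange S
  map_add' := map_add _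
  map_smul' x y := by
    induction x with
    | zero => simp
    | add x₁ x₂ h₁ h₂ =>
      simp only [RingHom.id_apply] at h₁ h₂ ⊢
      rw [add_smul, map_add, h₁, h₂, add_smul]
    | tmul s a =>
      induction y with
      | zero => simp
      | add y₁ y₂ h₁ h₂ =>
        simp only [RingHom.id_apply] at h₁ h₂ ⊢
        rw [smul_add, map_add, h₁, h₂, map_add, smul_add]
      | tmul t m => simp [baseChange_tmul_smul_tmul]

variable (M Q)

/-- The canonical map `S ⊗_R Hom_A(M, Q) → Hom_{S ⊗_R A}(S ⊗_R M, S ⊗_R Q)`,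
`s ⊗ f ↦ (t ⊗ m ↦ s t ⊗ f m)`. -/
noncomputable def homBaseChange :
    S ⊗[R] (M →ₗ[A] Q) →+ (S ⊗[R] M →ₗ[S ⊗[R] A] S ⊗[R] Q) :=
  TensorProduct.liftAddHom
    { toFun := fun s =>
        { toFun := fun f => s • baseChangeMap R S A f
          map_zero' := by
            ext y
            simp [baseChangeMap]
          map_add' := fun f g => by
            ext y
            simp [baseChangeMap, LinearMap.baseChange_add] }
      map_zero' := by
        ext f y
        simp
      map_add' := fun s t => by
        ext f y
        simp [add_smul] }
    (fun r s f => by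
      ext y
      simp [baseChangeMap, smul_comm r s])

theorem homBaseChange_tmul_apply (s t : S) (f : M →ₗ[A] Q) (m : M) :
    homBaseChange R S A M Q (s ⊗ₜ[R] f) (t ⊗ₜ[R] m) = (s * t) ⊗ₜ[R] f m := by
  simp [homBaseChange, baseChangeMap, TensorProduct.smul_tmul']

end BaseChange

/-! ### Approximations and dominant dimension -/

section Coresolution

variable {R : Type*} [CommRing R] {A : Type*} [Ring A] [Algebra R A]
  {Q : Type w} [AddCommGroup Q] [Module A Q]
  {M : Type*} [AddCommGroup M] [Module R M] [Module A M] [IsScalarTower R A M]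
  {N : Type*} [AddCommGroup N] [Module R N] [Module A N] [IsScalarTower R A N]
  {X : Type*} [AddCommGroup X] [Module R X] [Module A X] [IsScalarTower R A X]
  {Y : Type*} [AddCommGroup Y] [Module R Y] [Module A Y] [IsScalarTower R A Y]

/-! Coresolutions can be truncated, so `n ≤ relDomDim` just says that a coresolution of length `n`
exists. It therefore suffices to show, by induction on `n`, that `M` has one of length `n` exactly
when every fibre `M(𝔪)` does.

The induction rests on independence of choices (`hasAddCoresolution_succ_iff`). For any
approximation `f : M → X` with `X ∈ add Q` and cokernel `C`, `M` has a coresolution of length `n +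
1` iff `f` splits over `R` and `C` has one of length `n`. This is a dual Schanuel argument: the
cokernels of two approximations become isomorphic after adding objects of `add Q`, and such summands
do not affect coresolutions.

A single `f : M → Q^k`, built from generators of `Hom_A(M, Q)`, then serves `R` and all fibres at
once. By the base change hypothesis, `f(𝔪)` is again an approximation, and its cokernel is `C(𝔪)`.
By Nakayama, `f` splits over `R` iff every `f(𝔪)` is injective
(`LinearMap.exists_leftInverse_of_injective_fibres`). When it splits, `C` is projective over `R`.

To continue with `C`, both hypotheses on `Hom_A(M, Q)` must pass to `Hom_A(C, Q)`. The sequence `0 →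
Hom_A(C, Q) → Hom_A(X, Q) → Hom_A(M, Q) → 0` splits over `R`, so this reduces to `X`, hence to
`End_A(Q)`. There it follows from projectivity of `DQ ⊗_A Q`, whose `R`-dual is `End_A(Q)`: a dual
basis of the former transposes to one of the latter (`exists_end_dualBasis`). -/

/-- Every map `M → Q` factors through `f : M → X`. -/
def IsApprox (Q : Type*) [AddCommGroup Q] [Module A Q] (f : M →ₗ[A] X) : Prop :=
  ∀ h : M →ₗ[A] Q, ∃ g : X →ₗ[A] Q, g ∘ₗ f = h

/-- The `A`-linear map `f` has an `R`-linear retraction. -/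
def IsSplitMono (R : Type*) [CommRing R] [Module R M] [Module R X] (f : M →ₗ[A] X) : Prop :=
  ∃ r : X →ₗ[R] M, ∀ m, r (f m) = m

theorem isSplitMono_iff {f : M →ₗ[A] X} :
    IsSplitMono R f ↔ Function.Injective f ∧ HasSplitRange R f := by
  constructor
  · intro h
    obtain ⟨r, hr⟩ := h
    refine ⟨Function.LeftInverse.injective hr, ?_⟩
    refine ⟨LinearMap.ker ((f.restrictScalars R).rangeRestrict ∘ₗ r), ?_⟩
    apply LinearMap.isCompl_of_proj
    rintro ⟨_, m, rfl⟩
    ext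
    simp [hr]
  · rintro ⟨hf, q, hq⟩
    let e := LinearEquiv.ofInjective (f.restrictScalars R) hf
    refine ⟨e.symm.toLinearMap ∘ₗ Submodule.projectionOnto _ q hq, fun m => ?_⟩
    have : f m = ((e m : LinearMap.range (f.restrictScalars R)) : X) := rfl
    rw [LinearMap.comp_apply, this, Submodule.projectionOnto_apply_left]
    simp

theorem HasSplitRange.of_comp {f : X →ₗ[A] Y} {p : M →ₗ[A] X} (hp : Function.Surjective p) :
    HasSplitRange R (f ∘ₗ p) ↔ HasSplitRange R f := by
  have : LinearMap.range ((f ∘ₗ p).restrictScalars R) = LinearMap.range (f.restrictScalars R) := by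
    ext y
    simp only [LinearMap.mem_range, LinearMap.coe_restrictScalars, LinearMap.comp_apply]
    exact ⟨fun ⟨x, hx⟩ => ⟨_, hx⟩, fun ⟨x, hx⟩ => by obtain ⟨z, rfl⟩ := hp x; exact ⟨z, hx⟩⟩
  rw [HasSplitRange, this, HasSplitRange]

theorem inAdd_iff : InAdd A Q X ↔
    ∃ (k : ℕ) (p : Fin k → Q →ₗ[A] X) (q : Fin k → X →ₗ[A] Q), ∀ x, ∑ j, p j (q j x) = x := by
  constructor
  · rintro ⟨k, i, p, h⟩
    refine ⟨k, fun j => p ∘ₗ LinearMap.single A (fun _ => Q) j,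
      fun j => LinearMap.proj j ∘ₗ i, fun x => ?_⟩
    have := LinearMap.congr_fun h x
    simp only [LinearMap.comp_apply, LinearMap.id_apply, LinearMap.coe_single, LinearMap.proj_apply]
      at this ⊢
    rw [← map_sum, LinearMap.sum_single_apply (φ := fun _ => Q), this]
  · rintro ⟨k, p, q, h⟩
    refine ⟨k, LinearMap.pi q, ∑ j, p j ∘ₗ LinearMap.proj j, ?_⟩
    ext x
    simpa using h x

theorem InAdd.pi (k : ℕ) : InAdd A Q (Fin k → Q) := ⟨k, LinearMap.id, LinearMap.id, rfl⟩

theorem InAdd.prod (hX : InAdd A Q X) (hY : InAdd A Q Y) : InAdd A Q (X × Y) := by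
  obtain ⟨k, i, p, h⟩ := hX
  obtain ⟨l, j, q, h'⟩ := hY
  let e : (Fin (k + l) → Q) ≃ₗ[A] (Fin k → Q) × (Fin l → Q) :=
    (LinearEquiv.funCongrLeft A Q finSumFinEquiv).trans
      (LinearEquiv.sumArrowLequivProdArrow (Fin k) (Fin l) A Q)
  refine ⟨k + l, e.symm.toLinearMap ∘ₗ i.prodMap j, p.prodMap q ∘ₗ e.toLinearMap, ?_⟩
  apply LinearMap.ext
  rintro ⟨x, y⟩
  have h1 := LinearMap.congr_fun h x
  have h2 := LinearMap.congr_fun h' y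
  simp only [LinearMap.comp_apply, LinearMap.id_apply] at h1 h2
  simp [h1, h2]

theorem IsApprox.factor {f : M →ₗ[A] X} (hf : IsApprox Q f) (hY : InAdd A Q Y) (g : M →ₗ[A] Y) :
    ∃ h : X →ₗ[A] Y, h ∘ₗ f = g := by
  obtain ⟨k, p, q, h⟩ := inAdd_iff.1 hY
  choose u hu using fun j => hf (q j ∘ₗ g)
  refine ⟨∑ j, p j ∘ₗ u j, ?_⟩
  ext m
  have := fun j => LinearMap.congr_fun (hu j) m
  simp only [LinearMap.comp_apply] at this
  simp [this, h]

theorem HasAddCoresolution.of_le {m n : ℕ} (hmn : m ≤ n) (h : HasAddCoresolution R A Q M n) :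
    HasAddCoresolution R A Q M m := by
  obtain ⟨X, _, _, _, _, ⟨c⟩⟩ := h
  exact ⟨X, _, _, _, _, ⟨
    { ι := c.ι
      d := c.d
      inAdd := fun i hi => c.inAdd i (by omega)
      injective := fun hi => c.injective (by omega)
      exact_zero := fun hi => c.exact_zero (by omega)
      exact_succ := fun i hi => c.exact_succ i (by omega)
      split_zero := fun hi => c.split_zero (by omega)
      split_succ := fun i hi => c.split_succ i (by omega)
      hom_surjective := fun hi => c.hom_surjective (by omega)
      hom_exact_zero := fun hi => c.hom_exact_zero (by omega)
      hom_exact_succ := fun i hi => c.hom_exact_succ i (by omega) }⟩⟩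

variable (R A Q M) in
theorem hasAddCoresolution_zero : HasAddCoresolution R A Q M 0 :=
  ⟨fun _ => PUnit, inferInstance, inferInstance, inferInstance, inferInstance, ⟨
    { ι := 0
      d := fun _ => 0
      inAdd := fun i hi => absurd hi (by omega)
      injective := fun hi => absurd hi (by omega)
      exact_zero := fun hi => absurd hi (by omega)
      exact_succ := fun i hi => absurd hi (by omega)
      split_zero := fun hi => absurd hi (by omega)
      split_succ := fun i hi => absurd hi (by omega)
      hom_surjective := fun hi => absurd hi (by omega)
      hom_exact_zero := fun hi => absurd hi (by omega)
      hom_exact_succ := fun i hi => absurd hi (by omega) }⟩⟩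

/-- The admissible lengths are closed downwards by truncation, so a finite bound on the supremum is
attained. Length `0` is unconstrained, which matches `0` being the value when no `n ≥ 1` occurs. -/
theorem natCast_le_relDomDim {n : ℕ} :
    (n : ℕ∞) ≤ relDomDim R A Q M ↔ HasAddCoresolution R A Q M n := by
  constructor
  · intro h
    by_contra hn
    have hn0 : n ≠ 0 := fun h0 => hn (h0 ▸ hasAddCoresolution_zero R A Q M)
    have : relDomDim R A Q M ≤ ((n - 1 : ℕ) : ℕ∞) := by
      refine iSup₂_le fun k hk => ?_
      have : k < n := by
        by_contra hkn
        exact hn (hk.2.of_le (by omega))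
      exact_mod_cast (by omega : k ≤ n - 1)
    have := h.trans this
    norm_cast at this
    omega
  · intro h
    rcases Nat.eq_zero_or_pos n with rfl | hn
    · simp
    · exact le_iSup₂ (f := fun (n : ℕ) (_ : 1 ≤ n ∧ HasAddCoresolution R A Q M n) => (n : ℕ∞))
        n ⟨hn, h⟩

theorem HasAddCoresolution.congr {n : ℕ} (e : M ≃ₗ[A] N) (h : HasAddCoresolution R A Q M n) :
    HasAddCoresolution R A Q N n := by
  obtain ⟨X, _, _, _, _, ⟨c⟩⟩ := h
  refine ⟨X, _, _, _, _, ⟨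
    { c with
      ι := c.ι ∘ₗ e.symm.toLinearMap
      injective := fun hi => (c.injective hi).comp e.symm.injective
      exact_zero := fun hi x => ?_
      split_zero := fun hi => (HasSplitRange.of_comp e.symm.surjective).2 (c.split_zero hi)
      hom_surjective := fun hi g => ?_
      hom_exact_zero := fun hi g => ?_ }⟩⟩
  · rw [c.exact_zero hi x]
    exact e.symm.surjective.range_comp c.ι ▸ Iff.rfl
  · obtain ⟨u, hu⟩ := c.hom_surjective hi (g ∘ₗ e.toLinearMap)
    refine ⟨u, LinearMap.ext fun y => ?_⟩
    simpa using LinearMap.congr_fun hu (e.symm y)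
  · rw [← c.hom_exact_zero hi g]
    constructor
    · intro h
      ext m
      simpa using LinearMap.congr_fun h (e m)
    · intro h
      ext m
      simpa using LinearMap.congr_fun h (e.symm m)

end Coresolution

/-! ### Splicing on and splitting off the first term of a coresolution -/

section Cons

variable {R : Type*} [CommRing R] {A : Type*} [Ring A] [Algebra R A]
  {Q : Type w} [AddCommGroup Q] [Module A Q]
  {M : Type*} [AddCommGroup M] [Module R M] [Module A M] [IsScalarTower R A M]
  {X : Type w} [AddCommGroup X] [Module R X] [Module A X] [IsScalarTower R A X]

/-- The family `X, Y 0, Y 1, …`. -/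
def ConsFamily (X : Type w) (Y : ℕ → Type w) : ℕ → Type w
  | 0 => X
  | i + 1 => Y i

instance (X : Type w) [h : AddCommGroup X] (Y : ℕ → Type w) [h' : ∀ i, AddCommGroup (Y i)] :
    ∀ i, AddCommGroup (ConsFamily X Y i)
  | 0 => h
  | i + 1 => h' i

instance (S : Type*) [Semiring S] (X : Type w) [AddCommGroup X] [h : Module S X] (Y : ℕ → Type w)
    [∀ i, AddCommGroup (Y i)] [h' : ∀ i, Module S (Y i)] : ∀ i, Module S (ConsFamily X Y i)
  | 0 => h
  | i + 1 => h' i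

instance (X : Type w) [AddCommGroup X] [Module R X] [Module A X] [h : IsScalarTower R A X]
    (Y : ℕ → Type w) [∀ i, AddCommGroup (Y i)] [∀ i, Module R (Y i)] [∀ i, Module A (Y i)]
    [h' : ∀ i, IsScalarTower R A (Y i)] : ∀ i, IsScalarTower R A (ConsFamily X Y i)
  | 0 => h
  | i + 1 => h' i

theorem HasAddCoresolution.cons {n : ℕ} (f : M →ₗ[A] X) (hX : InAdd A Q X) (hf : IsApprox Q f)
    (hs : IsSplitMono R f) (h : HasAddCoresolution R A Q (X ⧸ LinearMap.range f) n) :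
    HasAddCoresolution R A Q M (n + 1) := by
  obtain ⟨Y, i₁, i₂, i₃, i₄, ⟨c⟩⟩ := h
  let d : ∀ i, ConsFamily X Y i →ₗ[A] ConsFamily X Y (i + 1) := fun
    | 0 => c.ι ∘ₗ (LinearMap.range f).mkQ
    | i + 1 => c.d i
  have hpi := (LinearMap.range f).mkQ_surjective
  have h₁ (hn : 0 < n) (x : X) : c.ι ((LinearMap.range f).mkQ x) = 0 ↔ x ∈ Set.range f := by
    rw [map_eq_zero_iff _ (c.injective hn)]
    simp
  -- A map killing `f` descends to the cokernel and then extends along `c.ι`.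
  have h₂ (hn : 0 < n) (g : X →ₗ[A] Q) :
      g ∘ₗ f = 0 ↔ ∃ u : Y 0 →ₗ[A] Q, u ∘ₗ c.ι ∘ₗ (LinearMap.range f).mkQ = g := by
    constructor
    · intro hg
      have hle : LinearMap.range f ≤ LinearMap.ker g := LinearMap.range_le_ker_iff.2 hg
      obtain ⟨u, hu⟩ := c.hom_surjective hn ((LinearMap.range f).liftQ g hle)
      refine ⟨u, ?_⟩
      change u ∘ₗ c.ι = _ at hu
      rw [← LinearMap.comp_assoc, hu, Submodule.liftQ_mkQ]
    · rintro ⟨u, rfl⟩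
      rw [LinearMap.comp_assoc, LinearMap.comp_assoc, LinearMap.range_mkQ_comp,
        LinearMap.comp_zero, LinearMap.comp_zero]
  have h₃ (g : Y 0 →ₗ[A] Q) : g ∘ₗ c.ι ∘ₗ (LinearMap.range f).mkQ = 0 ↔ g ∘ₗ c.ι = 0 := by
    rw [← LinearMap.comp_assoc]
    exact ⟨fun h => (LinearMap.cancel_right hpi).1 (h.trans (LinearMap.zero_comp _).symm),
      fun h => by rw [h, LinearMap.zero_comp]⟩
  refine ⟨ConsFamily X Y, inferInstance, inferInstance, inferInstance, inferInstance, ⟨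
    { ι := f
      d := d
      inAdd := fun i hi => ?_
      injective := fun _ => (isSplitMono_iff.1 hs).1
      exact_zero := fun hi => h₁ (by omega)
      exact_succ := fun i hi => ?_
      split_zero := fun _ => (isSplitMono_iff.1 hs).2
      split_succ := fun i hi => ?_
      hom_surjective := fun _ => hf
      hom_exact_zero := fun hi => h₂ (by omega)
      hom_exact_succ := fun i hi => ?_ }⟩⟩
  · cases i with
    | zero => exact hX
    | succ i => exact c.inAdd i (by omega)
  · cases i with
    | zero =>
      intro y
      refine (c.exact_zero (by omega) y).trans ?_
      exact hpi.range_comp c.ι ▸ Iff.rfl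
    | succ i => exact c.exact_succ i (by omega)
  · cases i with
    | zero => exact (HasSplitRange.of_comp hpi).2 (c.split_zero (by omega))
    | succ i => exact c.split_succ i (by omega)
  · cases i with
    | zero => exact fun g => (h₃ g).trans (c.hom_exact_zero (by omega) g)
    | succ i => exact c.hom_exact_succ i (by omega)

theorem HasAddCoresolution.uncons {n : ℕ} (h : HasAddCoresolution R A Q M (n + 1)) :
    ∃ (X : Type w) (_ : AddCommGroup X) (_ : Module R X) (_ : Module A X)
      (_ : IsScalarTower R A X) (f : M →ₗ[A] X), InAdd A Q X ∧ IsApprox Q f ∧ IsSplitMono R f ∧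
        HasAddCoresolution R A Q (X ⧸ LinearMap.range f) n := by
  obtain ⟨Y, _, _, _, _, ⟨c⟩⟩ := h
  refine ⟨Y 0, inferInstance, inferInstance, inferInstance, inferInstance, c.ι, c.inAdd 0 (by omega),
    c.hom_surjective (by omega), isSplitMono_iff.2 ⟨c.injective (by omega), c.split_zero (by omega)⟩,
    ?_⟩
  -- In a coresolution of length one nothing is known about `c.d 0`, but then nothing is asked of
  -- the cokernel either.
  rcases Nat.eq_zero_or_pos n with rfl | hn
  · exact hasAddCoresolution_zero _ _ _ _
  have hpi := (LinearMap.range c.ι).mkQ_surjective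
  have hex := c.exact_zero (by omega)
  have hle : LinearMap.range c.ι ≤ LinearMap.ker (c.d 0) := (LinearMap.exact_iff.1 hex).ge
  let ι' := (LinearMap.range c.ι).liftQ (c.d 0) hle
  have hι' : ι' ∘ₗ (LinearMap.range c.ι).mkQ = c.d 0 := Submodule.liftQ_mkQ _ _ _
  refine ⟨fun i => Y (i + 1), inferInstance, inferInstance, inferInstance, inferInstance, ⟨
    { ι := ι'
      d := fun i => c.d (i + 1)
      inAdd := fun i hi => c.inAdd (i + 1) (by omega)
      injective := fun hi => ?_
      exact_zero := fun hi y => ?_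
      exact_succ := fun i hi => c.exact_succ (i + 1) (by omega)
      split_zero := fun hi => ?_
      split_succ := fun i hi => c.split_succ (i + 1) (by omega)
      hom_surjective := fun hi g => ?_
      hom_exact_zero := fun hi g => ?_
      hom_exact_succ := fun i hi => c.hom_exact_succ (i + 1) (by omega) }⟩⟩
  · rw [← LinearMap.ker_eq_bot]
    exact Submodule.ker_liftQ_eq_bot _ _ _ (LinearMap.exact_iff.1 hex).le
  · refine (c.exact_succ 0 (by omega) y).trans ?_
    rw [← hι']
    exact hpi.range_comp ι' ▸ Iff.rfl
  · rw [← HasSplitRange.of_comp hpi, hι']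
    exact c.split_succ 0 (by omega)
  · have : (g ∘ₗ (LinearMap.range c.ι).mkQ) ∘ₗ c.ι = 0 := by
      rw [LinearMap.comp_assoc, LinearMap.range_mkQ_comp, LinearMap.comp_zero]
    obtain ⟨u, hu⟩ := (c.hom_exact_zero (by omega) _).1 this
    refine ⟨u, (LinearMap.cancel_right hpi).1 ?_⟩
    rw [LinearMap.comp_assoc, hι']
    exact hu
  · refine Iff.trans ?_ (c.hom_exact_succ 0 (by omega) g)
    change g ∘ₗ ι' = 0 ↔ g ∘ₗ c.d 0 = 0
    rw [← hι', ← LinearMap.comp_assoc]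
    exact ⟨fun h => by rw [h, LinearMap.zero_comp],
      fun h => (LinearMap.cancel_right hpi).1 (h.trans (LinearMap.zero_comp _).symm)⟩

end Cons

/-! ### Independence of the chosen approximation -/

section Independence

variable {R : Type*} [CommRing R] {A : Type*} [Ring A] [Algebra R A]
  {Q : Type w} [AddCommGroup Q] [Module A Q]
  {M : Type*} [AddCommGroup M] [Module R M] [Module A M] [IsScalarTower R A M]
  {N : Type*} [AddCommGroup N] [Module R N] [Module A N] [IsScalarTower R A N]
  {C : Type*} [AddCommGroup C] [Module R C] [Module A C] [IsScalarTower R A C]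
  {X : Type w} [AddCommGroup X] [Module R X] [Module A X] [IsScalarTower R A X]
  {Y : Type w} [AddCommGroup Y] [Module R Y] [Module A Y] [IsScalarTower R A Y]

theorem HasAddCoresolution.of_exact {n : ℕ} {f : M →ₗ[A] X} {p : X →ₗ[A] C} (hX : InAdd A Q X)
    (hf : IsApprox Q f) (hs : IsSplitMono R f) (hfp : Function.Exact f p)
    (hp : Function.Surjective p) (h : HasAddCoresolution R A Q C n) :
    HasAddCoresolution R A Q M (n + 1) :=
  .cons f hX hf hs (h.congr (hfp.linearEquivOfSurjective hp).symm)

/-- If `f : N → Z` starts a coresolution of `N`, then `f × id : N × Y → Z × Y` is a split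
approximation with the same cokernel as `f`. -/
theorem HasAddCoresolution.prod {n : ℕ} (hY : InAdd A Q Y) (h : HasAddCoresolution R A Q N n) :
    HasAddCoresolution R A Q (N × Y) n := by
  cases n with
  | zero => exact hasAddCoresolution_zero _ _ _ _
  | succ n =>
    obtain ⟨Z, _, _, _, _, f, hZ, hf, ⟨r, hr⟩, hc⟩ := h.uncons
    refine .of_exact (f := f.prodMap LinearMap.id)
      (p := (LinearMap.range f).mkQ ∘ₗ LinearMap.fst A Z Y) (hZ.prod hY) ?_
      ⟨r.prodMap LinearMap.id, by simp [hr]⟩ ?_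
      ((LinearMap.range f).mkQ_surjective.comp Prod.fst_surjective) hc
    · intro k
      obtain ⟨u, hu⟩ := hf (k ∘ₗ LinearMap.inl A N Y)
      refine ⟨u.coprod (k ∘ₗ LinearMap.inr A N Y), LinearMap.prod_ext ?_ ?_⟩
      · ext a
        have h0 : k (0, 0) = 0 := map_zero k
        simpa [h0] using LinearMap.congr_fun hu a
      · ext
        simp
    · rintro ⟨z, y⟩
      simp

/-- Restricting an approximation `f : N × Y → Z` to `N` gives a split approximation of `N`. Its
cokernel is that of `f` enlarged by `Y`, because the projection to `Y` extends along `f` to some `k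
: Z → Y`. The extra summand is then absorbed by `HasAddCoresolution.prod`. -/
theorem HasAddCoresolution.of_prod {n : ℕ} (hY : InAdd A Q Y)
    (h : HasAddCoresolution R A Q (N × Y) n) : HasAddCoresolution R A Q N n := by
  cases n with
  | zero => exact hasAddCoresolution_zero _ _ _ _
  | succ n =>
    obtain ⟨Z, _, _, _, _, f, hZ, hf, ⟨r, hr⟩, hc⟩ := h.uncons
    obtain ⟨k, hk⟩ := hf.factor hY (LinearMap.snd A N Y)
    have hk' (a : N) (y : Y) : k (f (a, y)) = y := LinearMap.congr_fun hk (a, y)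
    refine .of_exact (f := f ∘ₗ LinearMap.inl A N Y) (p := (LinearMap.range f).mkQ.prod k) hZ ?_
      ⟨LinearMap.fst R N Y ∘ₗ r, fun a => by simp [hr]⟩ ?_ ?_ (hc.prod hY)
    · intro u
      obtain ⟨v, hv⟩ := hf (u ∘ₗ LinearMap.fst A N Y)
      refine ⟨v, LinearMap.ext fun a => ?_⟩
      simpa using LinearMap.congr_fun hv (a, 0)
    · intro z
      constructor
      · intro hz
        simp only [LinearMap.prod_apply, Function.prod, Submodule.mkQ_apply, Prod.mk_eq_zero,
          Submodule.Quotient.mk_eq_zero, LinearMap.mem_range] at hz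
        obtain ⟨⟨⟨a, y⟩, rfl⟩, hy⟩ := hz
        rw [hk'] at hy
        subst hy
        exact ⟨a, rfl⟩
      · rintro ⟨a, rfl⟩
        simp [hk']
    · rintro ⟨c, y⟩
      obtain ⟨z, rfl⟩ := (LinearMap.range f).mkQ_surjective c
      -- The correction lies in `range f`, so the class of `z` is unchanged, and `k` sends it to `y
      -- - k z`.
      refine ⟨z + f (0, y - k z), Prod.ext ?_ ?_⟩
      · simp
      · simp [hk']

/-- Whether `M` has a coresolution of length `n + 1` can be read off from any approximation. -/
theorem hasAddCoresolution_succ_iff {n : ℕ} {g : M →ₗ[A] Y} {p : Y →ₗ[A] C} (hY : InAdd A Q Y)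
    (hg : IsApprox Q g) (hgp : Function.Exact g p) (hp : Function.Surjective p) :
    HasAddCoresolution R A Q M (n + 1) ↔ IsSplitMono R g ∧ HasAddCoresolution R A Q C n := by
  refine ⟨fun h => ?_, fun h => h.2.of_exact hY hg h.1 hgp hp⟩
  obtain ⟨X, _, _, _, _, f, hX, hf, ⟨r, hr⟩, hc⟩ := h.uncons
  obtain ⟨α, hα⟩ := hf.factor hY g
  obtain ⟨β, hβ⟩ := hg.factor hX f
  replace hα (m : M) : α (f m) = g m := LinearMap.congr_fun hα m
  replace hβ (m : M) : β (g m) = f m := LinearMap.congr_fun hβ m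
  -- Since `β ∘ g = f`, a retraction of `f` composed with `β` retracts `g`.
  refine ⟨⟨r ∘ₗ β.restrictScalars R, fun m => by simp [hβ, hr]⟩, ?_⟩
  -- Both maps are cokernels of `(f, g) : M → X × Y`: the shear by `α` turns `(f, g)` into `(f, 0)`,
  -- and the shear by `β` turns it into `(0, g)`. Hence `coker f × Y ≅ C × X`.
  let E₁ : X × Y →ₗ[A] (X ⧸ LinearMap.range f) × Y :=
    ((LinearMap.range f).mkQ ∘ₗ LinearMap.fst A X Y).prod
      (LinearMap.snd A X Y - α ∘ₗ LinearMap.fst A X Y)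
  let E₂ : X × Y →ₗ[A] C × X :=
    (p ∘ₗ LinearMap.snd A X Y).prod (LinearMap.fst A X Y - β ∘ₗ LinearMap.snd A X Y)
  have h₁ : Function.Exact (f.prod g) E₁ := by
    rintro ⟨x, y⟩
    simp only [E₁, LinearMap.prod_apply, Function.prod, LinearMap.comp_apply, LinearMap.sub_apply,
      LinearMap.fst_apply, LinearMap.snd_apply, Submodule.mkQ_apply, Prod.mk_eq_zero,
      Submodule.Quotient.mk_eq_zero, LinearMap.mem_range, sub_eq_zero, Set.mem_range, Prod.mk.injEq]
    constructor
    · rintro ⟨⟨m, rfl⟩, rfl⟩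
      exact ⟨m, rfl, (hα m).symm⟩
    · rintro ⟨m, rfl, rfl⟩
      exact ⟨⟨m, rfl⟩, (hα m).symm⟩
  have h₂ : Function.Exact (f.prod g) E₂ := by
    rintro ⟨x, y⟩
    simp only [E₂, LinearMap.prod_apply, Function.prod, LinearMap.comp_apply, LinearMap.sub_apply,
      LinearMap.fst_apply, LinearMap.snd_apply, Prod.mk_eq_zero, hgp y,
      sub_eq_zero, Set.mem_range, Prod.mk.injEq]
    constructor
    · rintro ⟨⟨m, rfl⟩, rfl⟩
      exact ⟨m, (hβ m).symm, rfl⟩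
    · rintro ⟨m, rfl, rfl⟩
      exact ⟨⟨m, rfl⟩, (hβ m).symm⟩
  have s₁ : Function.Surjective E₁ := by
    rintro ⟨c, y⟩
    obtain ⟨x, rfl⟩ := (LinearMap.range f).mkQ_surjective c
    exact ⟨(x, y + α x), by simp [E₁]⟩
  have s₂ : Function.Surjective E₂ := by
    rintro ⟨c, x⟩
    obtain ⟨y, rfl⟩ := hp c
    exact ⟨(x + β y, y), by simp [E₂]⟩
  exact ((hc.prod hY).congr
    ((h₁.linearEquivOfSurjective s₁).symm.trans (h₂.linearEquivOfSurjective s₂))).of_prod hX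

end Independence

/-! ### Base change of approximations -/

section BaseChangeMaps

variable {R : Type*} [CommRing R] (S : Type*) [CommRing S] [Algebra R S]
  {A : Type*} [Ring A] [Algebra R A]
  {M : Type*} [AddCommGroup M] [Module R M] [Module A M] [IsScalarTower R A M]
  {X : Type*} [AddCommGroup X] [Module R X] [Module A X] [IsScalarTower R A X]
  {C : Type*} [AddCommGroup C] [Module R C] [Module A C] [IsScalarTower R A C]
  {Q : Type*} [AddCommGroup Q] [Module R Q] [Module A Q] [IsScalarTower R A Q]

@[simp]
theorem baseChangeMap_tmul (f : M →ₗ[A] X) (s : S) (m : M) :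
    baseChangeMap R S A f (s ⊗ₜ[R] m) = s ⊗ₜ[R] f m := rfl

theorem InAdd.baseChange (h : InAdd A Q X) : InAdd (S ⊗[R] A) (S ⊗[R] Q) (S ⊗[R] X) := by
  obtain ⟨k, p, q, h⟩ := inAdd_iff.1 h
  refine inAdd_iff.2 ⟨k, fun j => baseChangeMap R S A (p j), fun j => baseChangeMap R S A (q j),
    fun y => ?_⟩
  induction y with
  | zero => simp
  | add a b ha hb => simp only [map_add, Finset.sum_add_distrib, ha, hb]
  | tmul s v => simp only [baseChangeMap_tmul, ← TensorProduct.tmul_sum, h]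

theorem IsSplitMono.baseChange {f : M →ₗ[A] X} (h : IsSplitMono R f) :
    IsSplitMono S (baseChangeMap R S A f) := by
  obtain ⟨r, hr⟩ := h
  refine ⟨r.baseChange S, fun y => ?_⟩
  induction y with
  | zero => simp
  | add a b ha hb => simp only [map_add, ha, hb]
  | tmul s v => simp [hr]

theorem baseChangeMap_exact {f : M →ₗ[A] X} {p : X →ₗ[A] C} (h : Function.Exact f p)
    (hp : Function.Surjective p) :
    Function.Exact (baseChangeMap R S A f) (baseChangeMap R S A p) :=
  lTensor_exact S (f := f.restrictScalars R) (g := p.restrictScalars R) h hp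

theorem baseChangeMap_surjective {p : X →ₗ[A] C} (hp : Function.Surjective p) :
    Function.Surjective (baseChangeMap R S A p) :=
  LinearMap.lTensor_surjective S (g := p.restrictScalars R) hp

/-- Precomposition with `f : M → X`, as an `R`-linear map `Hom_A(X, Q) → Hom_A(M, Q)`. -/
def precomp (R : Type*) [CommRing R] [Algebra R A]
    (Q : Type*) [AddCommGroup Q] [Module R Q] [Module A Q] [IsScalarTower R A Q]
    (f : M →ₗ[A] X) : (X →ₗ[A] Q) →ₗ[R] (M →ₗ[A] Q) where
  toFun g := g ∘ₗ f
  map_add' _ _ := rfl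
  map_smul' _ _ := rfl

theorem homBaseChange_precomp (f : M →ₗ[A] X) (u : S ⊗[R] (X →ₗ[A] Q)) :
    homBaseChange R S A M Q ((precomp R Q f).lTensor S u) =
      homBaseChange R S A X Q u ∘ₗ baseChangeMap R S A f := by
  induction u with
  | zero => simp
  | add a b ha hb => simp only [map_add, ha, hb, LinearMap.add_comp]
  | tmul s g =>
    ext y
    induction y with
    | zero => simp
    | add a b ha hb => simp only [map_add, ha, hb]
    | tmul t m => simp [homBaseChange_tmul_apply, precomp]

/-- Every map `S ⊗ M → S ⊗ Q` comes from `S ⊗ Hom_A(M, Q)`, and tensoring keeps precomposition with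
`f` surjective. -/
theorem IsApprox.baseChange {f : M →ₗ[A] X} (hf : IsApprox Q f)
    (h : Function.Surjective (homBaseChange R S A M Q)) :
    IsApprox (S ⊗[R] Q) (baseChangeMap R S A f) := by
  intro g
  obtain ⟨u, rfl⟩ := h g
  obtain ⟨v, rfl⟩ := LinearMap.lTensor_surjective S (g := precomp R Q f) hf u
  exact ⟨_, (homBaseChange_precomp S f v).symm⟩

/-- `homBaseChange` is natural in its first argument, and `X` is a retract of a finite power of `Q`,
so bijectivity is inherited from `Q`. -/
theorem InAdd.homBaseChange_bijective (hX : InAdd A Q X)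
    (h : Function.Bijective (homBaseChange R S A Q Q)) :
    Function.Bijective (homBaseChange R S A X Q) := by
  obtain ⟨k, p, q, hpq⟩ := inAdd_iff.1 hX
  have key (u : S ⊗[R] (X →ₗ[A] Q)) :
      ∑ j, (precomp R Q (q j)).lTensor S ((precomp R Q (p j)).lTensor S u) = u := by
    induction u with
    | zero => simp
    | add a b ha hb => simp only [map_add, Finset.sum_add_distrib, ha, hb]
    | tmul s g =>
      simp only [LinearMap.lTensor_tmul, ← TensorProduct.tmul_sum]
      congr 1
      ext x
      simp [precomp, ← map_sum, hpq]
  constructor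
  · rw [injective_iff_map_eq_zero]
    intro u hu
    rw [← key u]
    refine Finset.sum_eq_zero fun j _ => ?_
    have : (precomp R Q (p j)).lTensor S u = 0 := by
      apply h.1
      rw [homBaseChange_precomp, hu, map_zero, LinearMap.zero_comp]
    rw [this, map_zero]
  · intro g
    choose v hv using fun j => h.2 (g ∘ₗ baseChangeMap R S A (p j))
    refine ⟨∑ j, (precomp R Q (q j)).lTensor S (v j), ?_⟩
    simp only [map_sum, homBaseChange_precomp, hv]
    ext y
    induction y with
    | zero => simp
    | add a b ha hb => simp only [map_add, ha, hb]
    | tmul s x =>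
      simp only [LinearMap.sum_apply, LinearMap.comp_apply, baseChangeMap_tmul, ← map_sum,
        ← TensorProduct.tmul_sum, hpq]

omit [Module R X] [IsScalarTower R A X] in
theorem InAdd.projective_hom (hX : InAdd A Q X) [Module.Projective R (Q →ₗ[A] Q)] :
    Module.Projective R (X →ₗ[A] Q) := by
  obtain ⟨k, p, q, hpq⟩ := inAdd_iff.1 hX
  have : Module.Projective R (Fin k → (Q →ₗ[A] Q)) :=
    .of_equiv (DFinsupp.linearEquivFunOnFintype (R := R) (M := fun _ : Fin k => Q →ₗ[A] Q))
  refine Module.Projective.of_split (M := Fin k → (Q →ₗ[A] Q))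
    (LinearMap.pi fun j => precomp R Q (p j)) (∑ j, precomp R Q (q j) ∘ₗ LinearMap.proj j) ?_
  ext g x
  simp [precomp, ← map_sum, hpq]

/-! ### Passing to the cokernel of an approximation -/

variable {f : M →ₗ[A] X} {p : X →ₗ[A] C}

omit [Module R M] [IsScalarTower R A M] [Module R X] [IsScalarTower R A X] [Module R C]
  [IsScalarTower R A C] in
theorem precomp_exact (hfp : Function.Exact f p) (hp : Function.Surjective p) :
    Function.Exact (precomp R Q p) (precomp R Q f) := by
  intro g
  constructor
  · intro hg
    have hle : LinearMap.ker p ≤ LinearMap.ker g := by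
      rw [LinearMap.exact_iff.1 hfp]
      exact LinearMap.range_le_ker_iff.2 hg
    refine ⟨(LinearMap.ker p).liftQ g hle ∘ₗ (p.quotKerEquivOfSurjective hp).symm.toLinearMap, ?_⟩
    ext x
    have : (p.quotKerEquivOfSurjective hp).symm (p x) = (LinearMap.ker p).mkQ x := by
      rw [LinearEquiv.symm_apply_eq]
      rfl
    simp [precomp, this]
  · rintro ⟨u, rfl⟩
    ext m
    simp [precomp, hfp.apply_apply_eq_zero]

omit [Module R X] [IsScalarTower R A X] [Module R C] [IsScalarTower R A C] in
theorem precomp_injective (hp : Function.Surjective p) : Function.Injective (precomp R Q p) :=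
  fun _ _ h => (LinearMap.cancel_right hp).1 h

omit [Module R M] [IsScalarTower R A M] [Module R X] [IsScalarTower R A X] [Module R C]
  [IsScalarTower R A C] in
-- For an approximation, `0 → Hom_A(C, Q) → Hom_A(X, Q) → Hom_A(M, Q) → 0` is exact, and it splits
-- because its last term is projective.
theorem exists_retraction_precomp (hfp : Function.Exact f p) (hp : Function.Surjective p)
    (hf : IsApprox Q f) [Module.Projective R (M →ₗ[A] Q)] :
    ∃ r : (X →ₗ[A] Q) →ₗ[R] (C →ₗ[A] Q), r ∘ₗ precomp R Q p = LinearMap.id := by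
  obtain ⟨s, hs⟩ := (precomp R Q f).exists_rightInverse_of_surjective
    (LinearMap.range_eq_top.2 hf)
  have h := (precomp_exact (R := R) (Q := Q) hfp hp).split_tfae'.out 0 1
  exact (h.1 ⟨precomp_injective hp, s, hs⟩).2

omit [Module R M] [IsScalarTower R A M] [Module R X] [IsScalarTower R A X] [Module R C]
  [IsScalarTower R A C] in
theorem projective_hom_coker (hfp : Function.Exact f p) (hp : Function.Surjective p)
    (hf : IsApprox Q f) [Module.Projective R (M →ₗ[A] Q)] [Module.Projective R (X →ₗ[A] Q)] :
    Module.Projective R (C →ₗ[A] Q) := by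
  obtain ⟨r, hr⟩ := exists_retraction_precomp (R := R) hfp hp hf
  exact Module.Projective.of_split _ r hr

/-- A diagram chase as in the five lemma. The row of `Hom` modules splits, so it stays exact,
including on the left, after tensoring with `S`; the `Hom` row of the base changed modules is left
exact. -/
theorem homBaseChange_bijective_coker (hfp : Function.Exact f p) (hp : Function.Surjective p)
    (hf : IsApprox Q f) [Module.Projective R (M →ₗ[A] Q)]
    (hX : Function.Bijective (homBaseChange R S A X Q))
    (hM : Function.Injective (homBaseChange R S A M Q)) :
    Function.Bijective (homBaseChange R S A C Q) := by
  obtain ⟨r, hr⟩ := exists_retraction_precomp (R := R) hfp hp hf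
  have hpS := baseChangeMap_surjective (R := R) S hp
  constructor
  · rw [injective_iff_map_eq_zero]
    intro u hu
    have h0 : (precomp R Q p).lTensor S u = 0 := by
      apply hX.1
      rw [homBaseChange_precomp, hu, map_zero, LinearMap.zero_comp]
    have : r.lTensor S ((precomp R Q p).lTensor S u) = u := by
      rw [← LinearMap.comp_apply, ← LinearMap.lTensor_comp, hr, LinearMap.lTensor_id]
      rfl
    rw [← this, h0, map_zero]
  · intro g
    obtain ⟨v, hv⟩ := hX.2 (g ∘ₗ baseChangeMap R S A p)
    have h0 : (precomp R Q f).lTensor S v = 0 := by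
      apply hM
      rw [homBaseChange_precomp, hv, map_zero]
      ext y
      simp [(baseChangeMap_exact (R := R) S hfp hp).apply_apply_eq_zero]
    obtain ⟨u, rfl⟩ := (lTensor_exact S (precomp_exact hfp hp) (g := precomp R Q f) hf v).1 h0
    refine ⟨u, (LinearMap.cancel_right hpS).1 ?_⟩
    rw [← homBaseChange_precomp, hv]

end BaseChangeMaps

/-! ### Split monomorphisms can be detected on fibres -/

section Fibres

variable {R : Type*} [CommRing R]

theorem exists_finite_dualBasis (R P : Type*) [CommRing R] [AddCommGroup P] [Module R P]
    [Module.Finite R P] [Module.Projective R P] :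
    ∃ (n : ℕ) (x : Fin n → P) (φ : Fin n → P →ₗ[R] R), ∀ y, ∑ i, φ i y • x i = y := by
  obtain ⟨n, f, g, -, -, h⟩ := Module.Finite.exists_comp_eq_id_of_projective R P
  refine ⟨n, fun i => f (Pi.single i 1), fun i => LinearMap.proj i ∘ₗ g, fun y => ?_⟩
  have := LinearMap.congr_fun h y
  rw [LinearMap.comp_apply, LinearMap.pi_apply_eq_sum_univ] at this
  have h1 (i : Fin n) : (fun j => if i = j then (1 : R) else 0) = Pi.single i 1 := by
    ext j
    simp [Pi.single_apply, eq_comm]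
  simp only [h1] at this
  exact this

/-- If `P ⧸ N ≠ 0`, its annihilator lies in some maximal `m`. But `P ⧸ N = m (P ⧸ N)`, so by
Nakayama an element congruent to `1` modulo `m` annihilates it, which is absurd. -/
theorem Submodule.eq_top_of_forall_maximal {P : Type*} [AddCommGroup P] [Module R P]
    [Module.Finite R P] (N : Submodule R P)
    (h : ∀ m : MaximalSpectrum R, N ⊔ m.asIdeal • (⊤ : Submodule R P) = ⊤) : N = ⊤ := by
  rw [← Submodule.Quotient.subsingleton_iff, ← Module.annihilator_eq_top_iff (R := R)]
  by_contra hne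
  obtain ⟨m, hm, hle⟩ := Ideal.exists_le_maximal _ hne
  have htop : (⊤ : Submodule R (P ⧸ N)) ≤ m • ⊤ := by
    have := congrArg (Submodule.map N.mkQ) (h ⟨m, hm⟩)
    rw [Submodule.map_sup, Submodule.map_smul'', Submodule.map_top, Submodule.range_mkQ,
      Submodule.mkQ_map_self, bot_sup_eq] at this
    exact this.ge
  obtain ⟨r, hr, hr'⟩ := Submodule.exists_sub_one_mem_and_smul_eq_zero_of_fg_of_le_smul m
    (⊤ : Submodule R (P ⧸ N)) Module.Finite.fg_top htop
  have hrm : r ∈ m := hle (Module.mem_annihilator.2 fun y => hr' y trivial)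
  exact hm.ne_top ((Ideal.eq_top_iff_one _).2 (by simpa using m.sub_mem hrm hr))

variable {M : Type*} [AddCommGroup M] [Module R M] [Module.Finite R M] [Module.Projective R M]
  {X : Type*} [AddCommGroup X] [Module R X] [Module.Projective R X]

theorem LinearMap.mem_smul_top_of_range_le {N : Type*} [AddCommGroup N] [Module R N] (I : Ideal R)
    (h : M →ₗ[R] N) (hI : ∀ x, h x ∈ I • (⊤ : Submodule R N)) :
    h ∈ I • (⊤ : Submodule R (M →ₗ[R] N)) := by
  obtain ⟨n, x, φ, hx⟩ := exists_finite_dualBasis R M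
  have : h = ∑ i, LinearMap.smulRightₗ (φ i) (h (x i)) := by
    ext y
    conv_lhs => rw [← hx y]
    simp
  rw [this]
  refine Submodule.sum_mem _ fun i _ => ?_
  have := Submodule.mem_map_of_mem (f := LinearMap.smulRightₗ (φ i)) (hI (x i))
  rw [Submodule.map_smul''] at this
  exact Submodule.smul_mono le_rfl le_top this

theorem LinearMap.exists_leftInverse_of_injective_fibres [IsNoetherianRing R] (f : M →ₗ[R] X)
    (hf : ∀ m : MaximalSpectrum R, Function.Injective (f.lTensor (R ⧸ m.asIdeal))) :
    ∃ r : X →ₗ[R] M, r ∘ₗ f = LinearMap.id := by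
  -- All of `End_R(M)`, not only the identity, is shown to factor through `f`, so that Nakayama
  -- applies to the image of `Hom_R(X, M)`.
  suffices h : LinearMap.range (LinearMap.lcomp R M f) = ⊤ from LinearMap.range_eq_top.1 h _
  refine Submodule.eq_top_of_forall_maximal _ fun m => ?_
  rw [eq_top_iff]
  intro g _
  let _ : Field (R ⧸ m.asIdeal) := Ideal.Quotient.field m.asIdeal
  obtain ⟨ρ, hρ⟩ := (f.baseChange (R ⧸ m.asIdeal)).exists_leftInverse_of_injective
    (LinearMap.ker_eq_bot.2 (hf m))
  have hsurj : Function.Surjective (TensorProduct.mk R (R ⧸ m.asIdeal) M 1) :=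
    TensorProduct.mk_surjective R M (R ⧸ m.asIdeal) Ideal.Quotient.mk_surjective
  -- On the fibre, `g` factors through `f` as `(g ∘ ρ) ∘ f`. Projectivity of `X` lifts `g ∘ ρ` to
  -- `g' : X → M`, so `g - g' ∘ f` takes values in `𝔪 M`.
  obtain ⟨g', hg'⟩ := Module.projective_lifting_property (TensorProduct.mk R (R ⧸ m.asIdeal) M 1)
    (((g.baseChange (R ⧸ m.asIdeal) ∘ₗ ρ).restrictScalars R) ∘ₗ
      TensorProduct.mk R (R ⧸ m.asIdeal) X 1) hsurj
  have key : g - g' ∘ₗ f ∈ m.asIdeal • (⊤ : Submodule R (M →ₗ[R] M)) := by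
    refine LinearMap.mem_smul_top_of_range_le _ _ fun x => ?_
    have h₁ := LinearMap.congr_fun hg' (f x)
    have h₂ := LinearMap.congr_fun hρ ((1 : R ⧸ m.asIdeal) ⊗ₜ x)
    simp only [LinearMap.comp_apply, LinearMap.baseChange_tmul, LinearMap.id_apply,
      LinearMap.restrictScalars_apply, TensorProduct.mk_apply] at h₁ h₂
    rw [h₂, LinearMap.baseChange_tmul] at h₁
    have h₃ := congrArg (TensorProduct.quotTensorEquivQuotSMul M m.asIdeal) h₁
    rw [← map_one (Ideal.Quotient.mk m.asIdeal), TensorProduct.quotTensorEquivQuotSMul_mk_tmul,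
      TensorProduct.quotTensorEquivQuotSMul_mk_tmul, one_smul, one_smul] at h₃
    exact (Submodule.Quotient.eq _).1 h₃.symm
  rw [← add_sub_cancel (g' ∘ₗ f) g]
  exact Submodule.add_mem_sup ⟨g', rfl⟩ key

end Fibres

/-! ### Endomorphisms and the tensor product `DQ ⊗_A Q` -/

section Endomorphisms

variable (R : Type*) [CommRing R] (A : Type*) [Ring A] [Algebra R A]
  (Q : Type*) [AddCommGroup Q] [Module R Q] [Module A Q] [IsScalarTower R A Q]

/-- The canonical bilinear map `DQ × Q → DQ ⊗_A Q`. -/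
noncomputable def dualTensorMk : (Q →ₗ[R] R) →ₗ[R] Q →ₗ[R] DualTensor R A Q :=
  letI : Module Aᵐᵒᵖ (Q →ₗ[R] R) := dualRightModule R A Q
  (TensorProduct.mk R (Q →ₗ[R] R) Q).compr₂ (Submodule.mkQ _)

variable {R A Q}

theorem dualTensorMk_balanced (f : Q →ₗ[R] R) (a : A) (q : Q) :
    dualTensorMk R A Q (f ∘ₗ Algebra.lsmul R R Q a) q = dualTensorMk R A Q f (a • q) := by
  let _ : Module Aᵐᵒᵖ (Q →ₗ[R] R) := dualRightModule R A Q
  exact (Submodule.Quotient.eq _).2 (Submodule.subset_span ⟨f, a, q, rfl⟩)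

theorem DualTensor.induction {p : DualTensor R A Q → Prop}
    (mk : ∀ f q, p (dualTensorMk R A Q f q)) (add : ∀ x y, p x → p y → p (x + y)) (t) : p t := by
  let _ : Module Aᵐᵒᵖ (Q →ₗ[R] R) := dualRightModule R A Q
  obtain ⟨t, rfl⟩ := Submodule.mkQ_surjective _ t
  induction t with
  | zero =>
    have := mk 0 0
    rwa [map_zero] at this
  | add x y hx hy =>
    rw [map_add]
    exact add _ _ hx hy
  | tmul f q => exact mk f q

theorem DualTensor.exists_lift {W : Type*} [AddCommGroup W] [Module R W]
    (β : (Q →ₗ[R] R) →ₗ[R] Q →ₗ[R] W)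
    (hβ : ∀ f (a : A) q, β (f ∘ₗ Algebra.lsmul R R Q a) q = β f (a • q)) :
    ∃ θ : DualTensor R A Q →ₗ[R] W, ∀ f q, θ (dualTensorMk R A Q f q) = β f q := by
  let _ : Module Aᵐᵒᵖ (Q →ₗ[R] R) := dualRightModule R A Q
  refine ⟨Submodule.liftQ _ (TensorProduct.lift β) (Submodule.span_le.2 ?_), fun f q => ?_⟩
  · rintro _ ⟨f, a, q, rfl⟩
    rw [SetLike.mem_coe, LinearMap.mem_ker, map_sub, TensorProduct.lift.tmul,
      TensorProduct.lift.tmul, sub_eq_zero]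
    exact hβ f a q
  · exact TensorProduct.lift.tmul f q

variable (S : Type*) [CommRing S] [Algebra R S]

/-- The `S`-linear extension `S ⊗ V → S` of `f : V → R`. -/
noncomputable def extendFunctional {V : Type*} [AddCommGroup V] [Module R V] (f : V →ₗ[R] R) :
    S ⊗[R] V →ₗ[S] S :=
  LinearMap.liftBaseChange S (Algebra.linearMap R S ∘ₗ f)

@[simp]
theorem extendFunctional_tmul {V : Type*} [AddCommGroup V] [Module R V] (f : V →ₗ[R] R) (s : S)
    (v : V) : extendFunctional S f (s ⊗ₜ v) = s * algebraMap R S (f v) := by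
  simp [extendFunctional]

theorem extendFunctional_add {V : Type*} [AddCommGroup V] [Module R V] (f g : V →ₗ[R] R)
    (y : S ⊗[R] V) :
    extendFunctional S (f + g) y = extendFunctional S f y + extendFunctional S g y := by
  induction y with
  | zero => simp
  | add a b ha hb => simp only [map_add, ha, hb]; abel
  | tmul s v => simp [mul_add]

theorem extendFunctional_smul {V : Type*} [AddCommGroup V] [Module R V] (r : R) (f : V →ₗ[R] R)
    (y : S ⊗[R] V) : extendFunctional S (r • f) y = r • extendFunctional S f y := by
  induction y with
  | zero => simp
  | add a b ha hb => simp only [map_add, ha, hb, smul_add]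
  | tmul s v => simp [Algebra.smul_def, mul_left_comm]

theorem sum_extendFunctional_tmul {V : Type*} [AddCommGroup V] [Module R V] {n : ℕ}
    {x : Fin n → V} {φ : Fin n → V →ₗ[R] R} (h : ∀ v, ∑ i, φ i v • x i = v) (y : S ⊗[R] V) :
    ∑ i, extendFunctional S (φ i) y ⊗ₜ[R] x i = y := by
  induction y with
  | zero => simp
  | add a b ha hb => simp only [map_add, TensorProduct.add_tmul, Finset.sum_add_distrib, ha, hb]
  | tmul s v =>
    have (i : Fin n) : (s * algebraMap R S (φ i v)) ⊗ₜ[R] x i = s ⊗ₜ[R] (φ i v • x i) := by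
      rw [mul_comm, ← Algebra.smul_def, TensorProduct.smul_tmul]
    simp only [extendFunctional_tmul, this, ← TensorProduct.tmul_sum, h]

theorem extendFunctional_lsmul (f : Q →ₗ[R] R) (a : A) (y : S ⊗[R] Q) :
    extendFunctional S (f ∘ₗ Algebra.lsmul R R Q a) y =
      extendFunctional S f (((1 : S) ⊗ₜ[R] a) • y) := by
  induction y with
  | zero => simp
  | add b c hb hc => simp only [map_add, smul_add, hb, hc]
  | tmul s v => simp [baseChange_tmul_smul_tmul]

variable [Module.Finite R Q] [Module.Projective R Q]

theorem eq_of_forall_functional {x y : Q} (h : ∀ f : Q →ₗ[R] R, f x = f y) : x = y := by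
  obtain ⟨n, b, φ, hb⟩ := exists_finite_dualBasis R Q
  rw [← hb x, ← hb y]
  simp only [h]

theorem eq_of_forall_extendFunctional {x y : S ⊗[R] Q}
    (h : ∀ f : Q →ₗ[R] R, extendFunctional S f x = extendFunctional S f y) : x = y := by
  obtain ⟨n, b, φ, hb⟩ := exists_finite_dualBasis R Q
  rw [← sum_extendFunctional_tmul S hb x, ← sum_extendFunctional_tmul S hb y]
  simp only [h]

/-- Functionals on `DQ ⊗_A Q` come from endomorphisms of `Q`. -/
theorem exists_end_of_functional (τ : DualTensor R A Q →ₗ[R] R) :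
    ∃ e : Q →ₗ[A] Q, ∀ (f : Q →ₗ[R] R) q, f (e q) = τ (dualTensorMk R A Q f q) := by
  obtain ⟨n, x, φ, hx⟩ := exists_finite_dualBasis R Q
  -- `e q` is the element of `Q ≅ DDQ` representing the functional `f ↦ τ (f ⊗ q)`. Balancedness of
  -- the tensor product makes `e` linear over `A`.
  let e : Q →ₗ[R] Q := ∑ i, (τ ∘ₗ dualTensorMk R A Q (φ i)).smulRight (x i)
  have he (f : Q →ₗ[R] R) (q) : f (e q) = τ (dualTensorMk R A Q f q) := by
    have hf : f = ∑ i, f (x i) • φ i := by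
      ext y
      conv_lhs => rw [← hx y]
      simp [mul_comm]
    conv_rhs => rw [hf]
    simp [e, mul_comm]
  refine ⟨{ e with map_smul' := fun a q => ?_ }, he⟩
  refine eq_of_forall_functional (R := R) fun f => ?_
  change f (e (a • q)) = (f ∘ₗ Algebra.lsmul R R Q a) (e q)
  rw [he, he, dualTensorMk_balanced]

variable (R A Q) in
/-- If `DQ ⊗_A Q` is projective over `R`, then `End_A(Q)` has a finite dual basis whose functionals
are induced by elements of `DQ ⊗_A Q`. -/
theorem exists_end_dualBasis [Module.Projective R (DualTensor R A Q)] :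
    ∃ (L : DualTensor R A Q →ₗ[R] (Q →ₗ[A] Q) →ₗ[R] R) (n : ℕ) (t : Fin n → DualTensor R A Q)
      (τ : Fin n → DualTensor R A Q →ₗ[R] R) (e : Fin n → Q →ₗ[A] Q),
      (∀ f q φ, L (dualTensorMk R A Q f q) φ = f (φ q)) ∧ (∀ y, ∑ j, τ j y • t j = y) ∧
      (∀ j f q, f (e j q) = τ j (dualTensorMk R A Q f q)) ∧ ∀ φ, ∑ j, L (t j) φ • e j = φ := by
  obtain ⟨L, hL⟩ := DualTensor.exists_lift (R := R) (A := A) (Q := Q)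
    (W := (Q →ₗ[A] Q) →ₗ[R] R) (LinearMap.mk₂ R
      (fun f q =>
        { toFun := fun φ => f (φ q)
          map_add' := by simp
          map_smul' := by simp })
      (fun _ _ _ => rfl) (fun _ _ _ => rfl) (fun _ _ _ => by ext; simp)
      (fun _ _ _ => by ext; simp)) (fun f a q => by ext; simp)
  obtain ⟨n, t, τ, ht⟩ := exists_finite_dualBasis R (DualTensor R A Q)
  choose e he using fun j => exists_end_of_functional (τ j)
  have hL' (f : Q →ₗ[R] R) (q : Q) (φ : Q →ₗ[A] Q) : L (dualTensorMk R A Q f q) φ = f (φ q) := by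
    rw [hL]
    rfl
  refine ⟨L, n, t, τ, e, hL', ht, he, fun φ => ?_⟩
  ext q
  refine eq_of_forall_functional (R := R) fun f => ?_
  rw [← hL' f q φ]
  conv_rhs => rw [← ht (dualTensorMk R A Q f q)]
  simp [he, mul_comm]

variable (R A Q) in
theorem projective_end [Module.Projective R (DualTensor R A Q)] :
    Module.Projective R (Q →ₗ[A] Q) := by
  obtain ⟨L, n, t, τ, e, -, -, -, h⟩ := exists_end_dualBasis R A Q
  refine Module.Projective.of_split (M := Fin n → R) (LinearMap.pi fun j => L (t j))
    (∑ j, (LinearMap.proj j : (Fin n → R) →ₗ[R] R).smulRight (e j)) ?_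
  apply LinearMap.ext
  intro φ
  simpa using h φ

variable (R A Q) in
-- The dual basis of `exists_end_dualBasis` recovers `u` as `∑ L(t j)(u) ⊗ e j`. Its coefficients
-- are determined by the image of `u`, since for `x = f ⊗ q` the value `L(x)(u)` is `f` applied to
-- the image of `u` at `1 ⊗ q`. Conversely, `g` defines a functional `θ : f ⊗ q ↦ f (g (1 ⊗ q))` on
-- `DQ ⊗_A Q` with values in `S`, and `∑ θ(t j) ⊗ e j` maps to `g`.
theorem homBaseChange_end_bijective [Module.Projective R (DualTensor R A Q)] :
    Function.Bijective (homBaseChange R S A Q Q) := by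
  obtain ⟨L, n, t, τ, e, hL, ht, he, h⟩ := exists_end_dualBasis R A Q
  constructor
  · rw [injective_iff_map_eq_zero]
    intro u hu
    have key (x : DualTensor R A Q) : extendFunctional S (L x) u = 0 := by
      induction x using DualTensor.induction with
      | add x y hx hy => rw [map_add, extendFunctional_add, hx, hy, add_zero]
      | mk f q =>
        have : extendFunctional S (L (dualTensorMk R A Q f q)) u =
            extendFunctional S f (homBaseChange R S A Q Q u (1 ⊗ₜ q)) := by
          clear hu
          induction u with
          | zero => simp
          | add a b ha hb => simp only [map_add, LinearMap.add_apply, ha, hb]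
          | tmul s φ => simp [homBaseChange_tmul_apply, hL]
        rw [this, hu, LinearMap.zero_apply, map_zero]
    rw [← sum_extendFunctional_tmul S h u]
    simp [key]
  · intro g
    obtain ⟨θ, hθ⟩ := DualTensor.exists_lift (R := R) (A := A) (Q := Q) (W := S) (LinearMap.mk₂ R
      (fun f q => extendFunctional S f (g (1 ⊗ₜ q)))
      (fun _ _ _ => extendFunctional_add S _ _ _) (fun _ _ _ => extendFunctional_smul S _ _ _)
      (fun f x y => by rw [TensorProduct.tmul_add, map_add, map_add])
      (fun r f x => by
        -- Since `g` is only known to be linear over `S ⊗ A`, the scalar `r` is moved through it as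
        -- `r ⊗ 1`.
        have : (1 : S) ⊗ₜ[R] (r • x) = (algebraMap R S r ⊗ₜ[R] (1 : A)) • ((1 : S) ⊗ₜ[R] x) := by
          rw [baseChange_tmul_smul_tmul, one_smul, mul_one, TensorProduct.tmul_smul,
            TensorProduct.smul_tmul', Algebra.smul_def, mul_one]
        have h' (y : S ⊗[R] Q) : (algebraMap R S r ⊗ₜ[R] (1 : A)) • y = algebraMap R S r • y := by
          induction y with
          | zero => simp
          | add a b ha hb => simp only [smul_add, ha, hb]
          | tmul s v =>
            rw [baseChange_tmul_smul_tmul, one_smul, TensorProduct.smul_tmul', smul_eq_mul]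
        rw [this, map_smul, h', map_smul, algebraMap_smul]))
      (fun f a q => by
        simp only [LinearMap.mk₂_apply]
        rw [extendFunctional_lsmul, ← map_smul, baseChange_tmul_smul_tmul, mul_one])
    refine ⟨∑ j, θ (t j) ⊗ₜ[R] e j, ?_⟩
    have key (q : Q) : homBaseChange R S A Q Q (∑ j, θ (t j) ⊗ₜ[R] e j) (1 ⊗ₜ q) = g (1 ⊗ₜ q) := by
      refine eq_of_forall_extendFunctional (R := R) S fun f => ?_
      have := hθ f q
      rw [LinearMap.mk₂_apply] at this
      rw [← this]
      conv_rhs => rw [← ht (dualTensorMk R A Q f q)]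
      simp [homBaseChange_tmul_apply, he, Algebra.smul_def, mul_comm]
    ext y
    induction y with
    | zero => simp
    | add a b ha hb => simp only [map_add, ha, hb]
    | tmul s q =>
      have : s ⊗ₜ[R] q = (s ⊗ₜ[R] (1 : A)) • ((1 : S) ⊗ₜ[R] q) := by
        rw [baseChange_tmul_smul_tmul, one_smul, mul_one]
      rw [this, map_smul, map_smul, key]

end Endomorphisms

/-! ### Dominant dimension and fibres -/

section Fibrewise

variable {R : Type*} [CommRing R] {A : Type*} [Ring A] [Algebra R A]

theorem Module.Projective.pi_const (R P : Type*) [Semiring R] [AddCommMonoid P] [Module R P]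
    [Module.Projective R P] (k : ℕ) : Module.Projective R (Fin k → P) :=
  .of_equiv (DFinsupp.linearEquivFunOnFintype (R := R) (M := fun _ : Fin k => P))

variable {M : Type*} [AddCommGroup M] [Module R M] [Module A M] [IsScalarTower R A M]

/-- Finitely many generators of `Hom_A(M, Q)` over `R` are the components of the approximation; they
exist because `Hom_A(M, Q)` embeds in the Noetherian module `Hom_R(M, Q)`. -/
theorem exists_isApprox [IsNoetherianRing R] [Module.Finite R M] (Q : Type*) [AddCommGroup Q]
    [Module R Q] [Module A Q] [IsScalarTower R A Q] [Module.Finite R Q] :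
    ∃ (k : ℕ) (f : M →ₗ[A] (Fin k → Q)), IsApprox Q f := by
  let φ : (M →ₗ[A] Q) →ₗ[R] (M →ₗ[R] Q) :=
    { toFun := fun f => f.restrictScalars R
      map_add' := fun _ _ => rfl
      map_smul' := fun _ _ => rfl }
  have : IsNoetherian R (M →ₗ[A] Q) :=
    isNoetherian_of_injective φ (LinearMap.restrictScalars_injective R)
  obtain ⟨k, g, hg⟩ := Module.Finite.exists_fin (R := R) (M := M →ₗ[A] Q)
  refine ⟨k, LinearMap.pi g, fun h => ?_⟩
  have hh : h ∈ Submodule.span R (Set.range g) := hg ▸ Submodule.mem_top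
  obtain ⟨c, rfl⟩ := (Submodule.mem_span_range_iff_exists_fun R).1 hh
  refine ⟨∑ j, c j • LinearMap.proj j, ?_⟩
  ext m
  simp

theorem IsSplitMono.projective_coker {X C : Type*} [AddCommGroup X] [Module R X] [Module A X]
    [AddCommGroup C] [Module R C] [Module A C] [IsScalarTower R A X] [IsScalarTower R A C]
    [Module.Projective R X] {f : M →ₗ[A] X} {p : X →ₗ[A] C} (hs : IsSplitMono R f)
    (hfp : Function.Exact f p) (hp : Function.Surjective p) : Module.Projective R C := by
  obtain ⟨r, hr⟩ := hs
  have hex : Function.Exact (f.restrictScalars R) (p.restrictScalars R) := hfp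
  have h := hex.split_tfae'.out 0 1
  obtain ⟨-, s, hs⟩ := h.2 ⟨hp, r, LinearMap.ext hr⟩
  exact .of_split s _ hs

variable [IsNoetherianRing R] [Module.Finite R A]
  {Q : Type w} [AddCommGroup Q] [Module R Q] [Module A Q] [IsScalarTower R A Q]
  [Module.Finite A Q] [Module.Projective R Q]

variable (Q) in
theorem hasAddCoresolution_succ_iff_fibres {n : ℕ} (hQ : Module.Projective R (DualTensor R A Q))
    [Module.Finite A M] [Module.Projective R M] (hHom : Module.Projective R (M →ₗ[A] Q))
    (hBaseChange : ∀ m : MaximalSpectrum R,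
      Function.Bijective (homBaseChange R (R ⧸ m.asIdeal) A M Q))
    (ih : ∀ (C : Type w) [AddCommGroup C] [Module R C] [Module A C] [IsScalarTower R A C]
      [Module.Finite A C] [Module.Projective R C], Module.Projective R (C →ₗ[A] Q) →
      (∀ m : MaximalSpectrum R, Function.Bijective (homBaseChange R (R ⧸ m.asIdeal) A C Q)) →
      (HasAddCoresolution R A Q C n ↔ ∀ m : MaximalSpectrum R,
        HasAddCoresolution (R ⧸ m.asIdeal) ((R ⧸ m.asIdeal) ⊗[R] A) ((R ⧸ m.asIdeal) ⊗[R] Q)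
          ((R ⧸ m.asIdeal) ⊗[R] C) n)) :
    HasAddCoresolution R A Q M (n + 1) ↔ ∀ m : MaximalSpectrum R,
      HasAddCoresolution (R ⧸ m.asIdeal) ((R ⧸ m.asIdeal) ⊗[R] A) ((R ⧸ m.asIdeal) ⊗[R] Q)
        ((R ⧸ m.asIdeal) ⊗[R] M) (n + 1) := by
  have : Module.Finite R Q := .trans A Q
  have : Module.Finite R M := .trans A M
  have : Module.Projective R (Q →ₗ[A] Q) := projective_end R A Q
  obtain ⟨k, f, hf⟩ := exists_isApprox (R := R) (A := A) (M := M) Q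
  have hX : InAdd A Q (Fin k → Q) := .pi k
  have : Module.Projective R ((Fin k → Q) →ₗ[A] Q) := hX.projective_hom
  have : Module.Projective R (Fin k → Q) := .pi_const R Q k
  let p := (LinearMap.range f).mkQ
  have hp : Function.Surjective p := (LinearMap.range f).mkQ_surjective
  have hfp : Function.Exact f p := LinearMap.exact_map_mkQ_range f
  have hfib (m : MaximalSpectrum R) := hasAddCoresolution_succ_iff (R := R ⧸ m.asIdeal) (n := n)
    (hX.baseChange (R := R) (R ⧸ m.asIdeal)) (hf.baseChange (R ⧸ m.asIdeal) (hBaseChange m).2)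
    (baseChangeMap_exact (R := R) (R ⧸ m.asIdeal) hfp hp)
    (baseChangeMap_surjective (R := R) (R ⧸ m.asIdeal) hp)
  rw [hasAddCoresolution_succ_iff hX hf hfp hp]
  simp only [hfib]
  have hsplit : IsSplitMono R f ↔ ∀ m : MaximalSpectrum R,
      IsSplitMono (R ⧸ m.asIdeal) (baseChangeMap R (R ⧸ m.asIdeal) A f) := by
    refine ⟨fun h m => h.baseChange _, fun h => ?_⟩
    obtain ⟨r, hr⟩ := LinearMap.exists_leftInverse_of_injective_fibres (f.restrictScalars R)
      fun m => (isSplitMono_iff.1 (h m)).1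
    exact ⟨r, LinearMap.congr_fun hr⟩
  rw [forall_and, ← hsplit]
  refine and_congr_right fun hs => ?_
  have : Module.Projective R ((Fin k → Q) ⧸ LinearMap.range f) := hs.projective_coker hfp hp
  exact ih _ (projective_hom_coker hfp hp hf) fun m => homBaseChange_bijective_coker _ hfp hp hf
    (hX.homBaseChange_bijective _ (homBaseChange_end_bijective R A Q _)) (hBaseChange m).1

theorem hasAddCoresolution_iff_fibres_of_univ (hQ : Module.Projective R (DualTensor R A Q)) (n : ℕ)
    (C : Type w) [AddCommGroup C] [Module R C] [Module A C] [IsScalarTower R A C]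
    [Module.Finite A C] [Module.Projective R C] (hHom : Module.Projective R (C →ₗ[A] Q))
    (hBaseChange : ∀ m : MaximalSpectrum R,
      Function.Bijective (homBaseChange R (R ⧸ m.asIdeal) A C Q)) :
    HasAddCoresolution R A Q C n ↔ ∀ m : MaximalSpectrum R,
      HasAddCoresolution (R ⧸ m.asIdeal) ((R ⧸ m.asIdeal) ⊗[R] A) ((R ⧸ m.asIdeal) ⊗[R] Q)
        ((R ⧸ m.asIdeal) ⊗[R] C) n := by
  induction n generalizing C with
  | zero => simp only [hasAddCoresolution_zero, implies_true]
  | succ n ih =>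
    exact hasAddCoresolution_succ_iff_fibres Q hQ hHom hBaseChange
      fun C _ _ _ _ _ _ h h' => ih C h h'

theorem hasAddCoresolution_iff_fibres (hQ : Module.Projective R (DualTensor R A Q)) (n : ℕ)
    [Module.Finite A M] [Module.Projective R M] (hHom : Module.Projective R (M →ₗ[A] Q))
    (hBaseChange : ∀ m : MaximalSpectrum R,
      Function.Bijective (homBaseChange R (R ⧸ m.asIdeal) A M Q)) :
    HasAddCoresolution R A Q M n ↔ ∀ m : MaximalSpectrum R,
      HasAddCoresolution (R ⧸ m.asIdeal) ((R ⧸ m.asIdeal) ⊗[R] A) ((R ⧸ m.asIdeal) ⊗[R] Q)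
        ((R ⧸ m.asIdeal) ⊗[R] M) n := by
  cases n with
  | zero => simp only [hasAddCoresolution_zero, implies_true]
  | succ n =>
    -- `M` may live in any universe, but the cokernel of `M → Q^k` lives in that of `Q`, so the
    -- induction proper is confined to that universe and only this first step involves `M`.
    exact hasAddCoresolution_succ_iff_fibres Q hQ hHom hBaseChange
      fun C _ _ _ _ _ _ h h' => hasAddCoresolution_iff_fibres_of_univ hQ n C h h'

end Fibrewise

theorem mainTheorem5
    (R : Type*) [CommRing R] [IsNoetherianRing R]
    (A : Type*) [Ring A] [Algebra R A] [Module.Finite R A] [Module.Projective R A]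
    (Q : Type*) [AddCommGroup Q] [Module R Q] [Module A Q] [IsScalarTower R A Q]
    [Module.Finite A Q] [Module.Projective R Q]
    (hQ : Module.Projective R (DualTensor R A Q))
    (M : Type*) [AddCommGroup M] [Module R M] [Module A M] [IsScalarTower R A M]
    [Module.Finite A M] [Module.Projective R M]
    (hHom : Module.Projective R (M →ₗ[A] Q))
    (hBaseChange : ∀ m : MaximalSpectrum R,
      Function.Bijective (homBaseChange R (R ⧸ m.asIdeal) A M Q)) :
    relDomDim R A Q M =
      ⨅ m : MaximalSpectrum R,
        relDomDim (R ⧸ m.asIdeal) ((R ⧸ m.asIdeal) ⊗[R] A)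
          ((R ⧸ m.asIdeal) ⊗[R] Q) ((R ⧸ m.asIdeal) ⊗[R] M) := by
  refine ENat.eq_of_forall_natCast_le_iff fun n => ?_
  rw [le_iInf_iff]
  simp only [natCast_le_relDomDim]
  exact hasAddCoresolution_iff_fibres hQ n hHom hBaseChange
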